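/- Let $D$ be the open unit disk in $\mathbb{C}$ and let $s>-1$ be real. Let $A^2_s(D)$ be the Hilbert space of holomorphic functions $f$ on $D$ with $$\|f\|_s^2=\int_D |f(z)|^2\,dv_s(z)<\infty,\qquad dv_s(z)=\frac{s+1}{\pi}\,(1-|z|^2)^s\,dA(z),$$ where $dA$ is Lebesgue area measure. A bounded operator $T$ on a Hilbert space is called essentially normal if $T^*T-TT^*$ is compact. Let $\varphi$ be an automorphism (biholomorphic self-map) of $D$. Then the composition operator $C_\varphi f=f\circ\varphi$ is a well-defined bounded operator on $A^2_s(D)$, and $C_\varphi$ is essentially normal if and only if $\varphi$ is a rotation, that is, $\varphi(z)=cz$ on $D$ for some constant $c$ with $|c|=1$. In particular, if $\varphi$ is a non-rotation automorphism of $D$, then $C_\varphi$ is not essentially normal on $A^2_s(D)$ for any real $s>-1$. -/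

import Mathlib

open MeasureTheory Metric Set Filter Topology
open scoped ENNReal

/-- The probability measure `dv_s(z) = (s + 1) (1 - |z|²)^s dA(z) / π` on the open unit disk
(extended by zero to the whole plane), where `dA` is Lebesgue area measure. -/
noncomputable def bergmanMeasure (s : ℝ) : Measure ℂ :=
  (volume.restrict (ball (0 : ℂ) 1)).withDensity
    fun z => ENNReal.ofReal ((s + 1) / Real.pi * (1 - ‖z‖ ^ 2) ^ s)

/-- `g` is a holomorphic function on the unit disk representing the class `f ∈ L²(dv_s)`. Such a
`g` is unique on the disk. -/
def IsHolomorphicRep (s : ℝ) (f : Lp ℂ 2 (bergmanMeasure s)) (g : ℂ → ℂ) : Prop :=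
  DifferentiableOn ℂ g (ball 0 1) ∧ (f : ℂ → ℂ) =ᵐ[bergmanMeasure s] g

/-- The weighted Bergman space `A²_s(D)`: the holomorphic functions on the disk which are square
integrable for `dv_s`, as a subspace of `L²(dv_s)` with the induced norm and inner product. -/
noncomputable def bergmanSpace (s : ℝ) : Submodule ℂ (Lp ℂ 2 (bergmanMeasure s)) where
  carrier := {f | ∃ g : ℂ → ℂ, IsHolomorphicRep s f g}
  zero_mem' := ⟨0, differentiableOn_const 0, Lp.coeFn_zero _ _ _⟩
  add_mem' := by
    rintro f₁ f₂ ⟨g₁, hd₁, h₁⟩ ⟨g₂, hd₂, h₂⟩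
    exact ⟨g₁ + g₂, hd₁.add hd₂, (Lp.coeFn_add f₁ f₂).trans (h₁.add h₂)⟩
  smul_mem' := by
    rintro c f ⟨g, hd, h⟩
    exact ⟨c • g, hd.const_smul c, (Lp.coeFn_smul c f).trans (h.const_smul c)⟩

/-- The area mean value property. -/
theorem integral_ball_eq_of_differentiableOn {g : ℂ → ℂ} {z : ℂ} {r : ℝ} (hr : 0 < r)
    (hg : DifferentiableOn ℂ g (closedBall z r)) :
    ∫ w in ball z r, g w = ((Real.pi * r ^ 2 : ℝ) : ℂ) * g z := by
  have hmap : ∀ ρ ∈ Icc (0 : ℝ) r, ∀ θ : ℝ, circleMap z ρ θ ∈ closedBall z r := by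
    intro ρ hρ θ
    have := circleMap_mem_sphere z hρ.1 θ
    exact closedBall_subset_closedBall hρ.2 (sphere_subset_closedBall this)
  have hcirc : ∀ ρ ∈ Ioo (0 : ℝ) r,
      ∫ θ in Ioo (-Real.pi) Real.pi, g (circleMap z ρ θ) = ((2 * Real.pi : ℝ) : ℂ) * g z := by
    intro ρ hρ
    have hsub : closedBall z |ρ| ⊆ closedBall z r := by
      rw [abs_of_pos hρ.1]; exact closedBall_subset_closedBall hρ.2.le
    have hd : DiffContOnCl ℂ g (ball z |ρ|) :=
      DifferentiableOn.diffContOnCl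
        (hg.mono (closure_ball_subset_closedBall.trans hsub))
    have h1 := hd.circleAverage
    rw [Real.circleAverage_def] at h1
    have h2 : ∫ θ in (-Real.pi)..Real.pi, g (circleMap z ρ θ)
        = ∫ θ in (0 : ℝ)..2 * Real.pi, g (circleMap z ρ θ) := by
      have hp : Function.Periodic (fun θ => g (circleMap z ρ θ)) (2 * Real.pi) := by
        intro θ
        simp only [periodic_circleMap z ρ θ]
      have := hp.intervalIntegral_add_eq (-Real.pi) 0
      convert this using 2 <;> ring
    rw [← integral_Ioc_eq_integral_Ioo, ← intervalIntegral.integral_of_le (by linarith [Real.pi_pos]),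
      h2, ← h1]
    rw [Complex.real_smul, ← mul_assoc, ← Complex.ofReal_mul,
      mul_inv_cancel₀ (by positivity), Complex.ofReal_one, one_mul]
  have hpolar : ∀ p : ℝ × ℝ, z + Complex.polarCoord.symm p = circleMap z p.1 p.2 := by
    intro p
    rw [Complex.polarCoord_symm_apply, circleMap, Complex.exp_mul_I, Complex.ofReal_cos,
      Complex.ofReal_sin]
  have h0 : ∫ w in ball z r, g w
      = ∫ p in Ioo (0 : ℝ) r ×ˢ Ioo (-Real.pi) Real.pi, p.1 • g (circleMap z p.1 p.2) := by
    rw [← integral_indicator measurableSet_ball,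
      ← integral_add_left_eq_self (fun w => (ball z r).indicator g w) z,
      ← Complex.integral_comp_polarCoord_symm]
    simp only [hpolar]
    have hsub : Ioo (0 : ℝ) r ×ˢ Ioo (-Real.pi) Real.pi ⊆ polarCoord.target := by
      intro p hp
      exact ⟨hp.1.1, hp.2⟩
    rw [setIntegral_eq_of_subset_of_forall_sdiff_eq_zero
      polarCoord.open_target.measurableSet hsub]
    · refine setIntegral_congr_fun (measurableSet_Ioo.prod measurableSet_Ioo) ?_
      intro p hp
      have : circleMap z p.1 p.2 ∈ ball z r := by
        have := circleMap_mem_sphere z hp.1.1.le p.2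
        rw [mem_sphere] at this
        rw [mem_ball, this]
        exact hp.1.2
      simp only [indicator_of_mem this]
    · intro p hp
      have hp1 : 0 < p.1 := hp.1.1
      have hge : r ≤ p.1 := by
        by_contra hlt
        exact hp.2 ⟨⟨hp1, not_le.1 hlt⟩, hp.1.2⟩
      have : circleMap z p.1 p.2 ∉ ball z r := by
        have := circleMap_mem_sphere z hp1.le p.2
        rw [mem_sphere] at this
        rw [mem_ball, this]
        exact not_lt.2 hge
      simp only [indicator_of_notMem this, smul_zero]
  have hint : IntegrableOn (fun p : ℝ × ℝ => p.1 • g (circleMap z p.1 p.2))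
      (Ioo (0 : ℝ) r ×ˢ Ioo (-Real.pi) Real.pi) (volume.prod volume) := by
    have hc : ContinuousOn (fun p : ℝ × ℝ => p.1 • g (circleMap z p.1 p.2))
        (Icc (0 : ℝ) r ×ˢ Icc (-Real.pi) Real.pi) := by
      refine continuousOn_fst.smul (hg.continuousOn.comp ?_ ?_)
      · unfold circleMap
        fun_prop
      · intro p hp
        exact hmap p.1 hp.1 p.2
    exact (hc.integrableOn_compact (isCompact_Icc.prod isCompact_Icc)).mono_set
      (prod_mono Ioo_subset_Icc_self Ioo_subset_Icc_self)
  rw [h0, Measure.volume_eq_prod, setIntegral_prod _ hint]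
  have h3 : ∀ ρ ∈ Ioo (0 : ℝ) r, ∫ θ in Ioo (-Real.pi) Real.pi, ρ • g (circleMap z ρ θ)
      = ((ρ : ℝ) : ℂ) * (((2 * Real.pi : ℝ) : ℂ) * g z) := by
    intro ρ hρ
    rw [integral_smul, hcirc ρ hρ, Complex.real_smul]
  rw [setIntegral_congr_fun measurableSet_Ioo h3, integral_mul_const, integral_complex_ofReal,
    ← integral_Ioc_eq_integral_Ioo, ← intervalIntegral.integral_of_le hr.le, integral_id]
  push_cast
  ring

/-- On a smaller disk, area measure is dominated by a multiple of `dv_s`. -/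
theorem exists_restrict_le_bergmanMeasure {s : ℝ} (hs : -1 < s) {ρ : ℝ} (hρ : ρ < 1) :
    ∃ C : ℝ≥0∞, C ≠ ∞ ∧ C ≠ 0 ∧
      volume.restrict (closedBall (0 : ℂ) ρ) ≤ C • bergmanMeasure s := by
  have hsub : closedBall (0 : ℂ) ρ ⊆ ball 0 1 := closedBall_subset_ball hρ
  have hpos : ∀ z ∈ ball (0 : ℂ) 1, 0 < (s + 1) / Real.pi * (1 - ‖z‖ ^ 2) ^ s := by
    intro z hz
    have hz' : ‖z‖ < 1 := by simpa using hz
    have h1 : 0 < 1 - ‖z‖ ^ 2 := by nlinarith [norm_nonneg z]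
    have h2 : 0 < s + 1 := by linarith
    have := Real.rpow_pos_of_pos h1 s
    positivity
  have hcont : ContinuousOn (fun z : ℂ => (s + 1) / Real.pi * (1 - ‖z‖ ^ 2) ^ s) (ball 0 1) := by
    refine continuousOn_const.mul (ContinuousOn.rpow_const (by fun_prop) ?_)
    intro z hz
    have hz' : ‖z‖ < 1 := by simpa using hz
    left
    nlinarith [norm_nonneg z]
  obtain ⟨m, hm, hle⟩ : ∃ m : ℝ, 0 < m ∧ ∀ z ∈ closedBall (0 : ℂ) ρ,
      m ≤ (s + 1) / Real.pi * (1 - ‖z‖ ^ 2) ^ s := by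
    rcases (closedBall (0 : ℂ) ρ).eq_empty_or_nonempty with he | hne
    · exact ⟨1, one_pos, by simp [he]⟩
    · obtain ⟨z₀, hz₀, hmin⟩ :=
        (isCompact_closedBall (0 : ℂ) ρ).exists_isMinOn hne (hcont.mono hsub)
      exact ⟨_, hpos z₀ (hsub hz₀), fun z hz => hmin hz⟩
  refine ⟨(ENNReal.ofReal m)⁻¹, by simp [hm], by simp, ?_⟩
  rw [Measure.le_iff]
  intro A hA
  rw [Measure.smul_apply, bergmanMeasure, withDensity_apply _ hA, Measure.restrict_apply hA,
    Measure.restrict_restrict hA, smul_eq_mul]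
  have hm0 : ENNReal.ofReal m ≠ 0 := by simp [hm]
  have hmt : ENNReal.ofReal m ≠ ∞ := ENNReal.ofReal_ne_top
  have hkey : ENNReal.ofReal m * volume (A ∩ closedBall (0 : ℂ) ρ)
      ≤ ∫⁻ z in A ∩ ball 0 1, ENNReal.ofReal ((s + 1) / Real.pi * (1 - ‖z‖ ^ 2) ^ s) := by
    calc ENNReal.ofReal m * volume (A ∩ closedBall (0 : ℂ) ρ)
        = ∫⁻ _ in A ∩ closedBall (0 : ℂ) ρ, ENNReal.ofReal m := by rw [setLIntegral_const]
      _ ≤ ∫⁻ z in A ∩ closedBall (0 : ℂ) ρ,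
            ENNReal.ofReal ((s + 1) / Real.pi * (1 - ‖z‖ ^ 2) ^ s) := by
          refine setLIntegral_mono' (hA.inter measurableSet_closedBall) ?_
          intro z hz
          exact ENNReal.ofReal_le_ofReal (hle z hz.2)
      _ ≤ _ := lintegral_mono_set (inter_subset_inter_right A hsub)
  calc volume (A ∩ closedBall (0 : ℂ) ρ)
      = (ENNReal.ofReal m)⁻¹ * (ENNReal.ofReal m * volume (A ∩ closedBall (0 : ℂ) ρ)) := by
        rw [← mul_assoc, ENNReal.inv_mul_cancel hm0 hmt, one_mul]
    _ ≤ _ := by gcongr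

/-- Point evaluations are bounded for the `L²(dv_s)` norm, uniformly on smaller disks. -/
theorem exists_enorm_le_eLpNorm {s : ℝ} (hs : -1 < s) {R : ℝ} (hR : R < 1) :
    ∃ C : ℝ≥0∞, C ≠ ∞ ∧ ∀ g : ℂ → ℂ, DifferentiableOn ℂ g (ball 0 1) →
      ∀ z ∈ closedBall (0 : ℂ) R, ‖g z‖ₑ ≤ C * eLpNorm g 2 (bergmanMeasure s) := by
  obtain ⟨C₀, hC₀, hC₀', hle⟩ :=
    exists_restrict_le_bergmanMeasure hs (ρ := (1 + R) / 2) (by linarith)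
  set r : ℝ := (1 - R) / 2 with hrdef
  have hr : 0 < r := by rw [hrdef]; linarith
  set V : ℝ≥0∞ := volume (ball (0 : ℂ) r) with hV
  have hVt : V ≠ ∞ := measure_ball_lt_top.ne
  set K : ℝ≥0∞ := ENNReal.ofReal (Real.pi * r ^ 2) with hK
  have hK0 : K ≠ 0 := by
    rw [hK]; simp only [ne_eq, ENNReal.ofReal_eq_zero, not_le]; positivity
  have hKt : K ≠ ∞ := ENNReal.ofReal_ne_top
  refine ⟨K⁻¹ * (C₀ ^ (1 / 2 : ℝ) * V ^ (1 / 2 : ℝ)), ?_, ?_⟩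
  · refine ENNReal.mul_ne_top (ENNReal.inv_ne_top.2 hK0) (ENNReal.mul_ne_top ?_ ?_)
    · exact ENNReal.rpow_ne_top_of_nonneg (by norm_num) hC₀
    · exact ENNReal.rpow_ne_top_of_nonneg (by norm_num) hVt
  intro g hg z hz
  have hz' : ‖z‖ ≤ R := by simpa using hz
  have hsub1 : ball z r ⊆ closedBall 0 ((1 + R) / 2) := by
    intro w hw
    have h1 : ‖w - z‖ < r := by simpa [dist_eq_norm] using hw
    have h2 : ‖w‖ ≤ ‖w - z‖ + ‖z‖ := by simpa using norm_add_le (w - z) z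
    rw [mem_closedBall, dist_zero_right]
    rw [hrdef] at h1
    linarith
  have hsub2 : closedBall z r ⊆ ball 0 1 := by
    intro w hw
    have h1 : ‖w - z‖ ≤ r := by simpa [dist_eq_norm] using hw
    have h2 : ‖w‖ ≤ ‖w - z‖ + ‖z‖ := by simpa using norm_add_le (w - z) z
    rw [mem_ball, dist_zero_right]
    rw [hrdef] at h1
    linarith
  have hmv := integral_ball_eq_of_differentiableOn hr (hg.mono hsub2)
  have hmeas : AEStronglyMeasurable g (volume.restrict (ball z r)) :=
    (hg.continuousOn.mono (ball_subset_closedBall.trans hsub2)).aestronglyMeasurable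
      measurableSet_ball
  have h1 : K * ‖g z‖ₑ ≤ eLpNorm g 1 (volume.restrict (ball z r)) := by
    have := enorm_integral_le_lintegral_enorm (μ := volume.restrict (ball z r)) g
    rw [hmv, enorm_mul] at this
    rw [eLpNorm_one_eq_lintegral_enorm]
    refine le_trans (le_of_eq ?_) this
    congr 1
    rw [hK, ← ofReal_norm, Complex.norm_real, Real.norm_of_nonneg (by positivity)]
  have h2 : eLpNorm g 1 (volume.restrict (ball z r))
      ≤ eLpNorm g 2 (volume.restrict (ball z r)) * V ^ (1 / 2 : ℝ) := by
    have := eLpNorm_le_eLpNorm_mul_rpow_measure_univ (p := 1) (q := 2) (by norm_num) hmeas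
    refine this.trans (le_of_eq ?_)
    rw [Measure.restrict_apply_univ, hV]
    congr 2
    · rw [Measure.addHaar_ball_center]
    · norm_num
  have h3 : eLpNorm g 2 (volume.restrict (ball z r))
      ≤ C₀ ^ (1 / 2 : ℝ) * eLpNorm g 2 (bergmanMeasure s) := by
    have := eLpNorm_mono_measure g (p := 2) ((Measure.restrict_mono_set volume hsub1).trans hle)
    rw [eLpNorm_smul_measure_of_ne_zero hC₀'] at this
    refine this.trans (le_of_eq ?_)
    rw [smul_eq_mul]
    norm_num
  calc ‖g z‖ₑ = K⁻¹ * (K * ‖g z‖ₑ) := by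
        rw [← mul_assoc, ENNReal.inv_mul_cancel hK0 hKt, one_mul]
    _ ≤ K⁻¹ * (C₀ ^ (1 / 2 : ℝ) * eLpNorm g 2 (bergmanMeasure s) * V ^ (1 / 2 : ℝ)) := by
        refine mul_le_mul_right (h1.trans (h2.trans ?_)) _
        exact mul_le_mul_left h3 _
    _ = _ := by ring

theorem ae_mem_ball_bergmanMeasure (s : ℝ) : ∀ᵐ z ∂bergmanMeasure s, z ∈ ball (0 : ℂ) 1 :=
  (withDensity_absolutelyContinuous _ _).ae_le (ae_restrict_mem measurableSet_ball)

theorem isClosed_bergmanSpace {s : ℝ} (hs : -1 < s) :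
    IsClosed (bergmanSpace s : Set (Lp ℂ 2 (bergmanMeasure s))) := by
  refine isClosed_of_closure_subset fun f hf => ?_
  obtain ⟨u, hu, hlim⟩ := mem_closure_iff_seq_limit.1 hf
  choose g hgd hg using hu
  have hcau : ∀ R : ℝ, R < 1 → UniformCauchySeqOn g atTop (closedBall 0 R) := by
    intro R hR
    obtain ⟨C, hC, hb⟩ := exists_enorm_le_eLpNorm hs hR
    rw [Metric.uniformCauchySeqOn_iff]
    intro ε hε
    have hcu := hlim.cauchySeq
    rw [Metric.cauchySeq_iff] at hcu
    obtain ⟨N, hN⟩ := hcu (ε / (C.toReal + 1)) (by positivity)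
    refine ⟨N, fun m hm n hn z hz => ?_⟩
    have h1 := hb (g m - g n) ((hgd m).sub (hgd n)) z hz
    have h2 : eLpNorm (g m - g n) 2 (bergmanMeasure s) = edist (u m) (u n) := by
      rw [Lp.edist_def]
      exact eLpNorm_congr_ae ((hg m).sub (hg n)).symm
    rw [h2] at h1
    have h3 := ENNReal.toReal_mono (ENNReal.mul_ne_top hC (edist_ne_top _ _)) h1
    rw [ENNReal.toReal_mul, toReal_enorm, ← dist_edist, Pi.sub_apply, ← dist_eq_norm] at h3
    have h4 := hN m hm n hn
    have h5 : 0 ≤ C.toReal := ENNReal.toReal_nonneg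
    have h6 : (C.toReal + 1) * dist (u m) (u n) < ε := by
      rw [lt_div_iff₀ (by positivity)] at h4
      linarith
    nlinarith [dist_nonneg (x := u m) (y := u n)]
  have hpt : ∀ z : ℂ, ∃ l : ℂ, z ∈ ball (0 : ℂ) 1 → Tendsto (fun n => g n z) atTop (𝓝 l) := by
    intro z
    by_cases hz : z ∈ ball (0 : ℂ) 1
    · have hz' : ‖z‖ < 1 := by simpa using hz
      obtain ⟨l, hl⟩ := cauchySeq_tendsto_of_complete
        ((hcau ‖z‖ hz').cauchySeq (x := z) (by simp))
      exact ⟨l, fun _ => hl⟩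
    · exact ⟨0, fun h => absurd h hz⟩
  choose G hG using hpt
  have hloc : TendstoLocallyUniformlyOn g G atTop (ball 0 1) := by
    rw [tendstoLocallyUniformlyOn_iff_forall_isCompact isOpen_ball]
    intro K hK hKc
    obtain ⟨R, hR, hKR⟩ : ∃ R : ℝ, R < 1 ∧ K ⊆ closedBall 0 R := by
      obtain ⟨R, hR, h⟩ := exists_lt_subset_ball hKc.isClosed hK
      exact ⟨R, hR, h.trans ball_subset_closedBall⟩
    exact ((hcau R hR).tendstoUniformlyOn_of_tendsto
      (fun z hz => hG z (closedBall_subset_ball hR hz))).mono hKR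
  refine ⟨G, hloc.differentiableOn (Eventually.of_forall hgd) isOpen_ball, ?_⟩
  obtain ⟨ns, hns, hae⟩ := (tendstoInMeasure_of_tendsto_Lp hlim).exists_seq_tendsto_ae
  have hall : ∀ᵐ z ∂bergmanMeasure s, ∀ n, (u n : ℂ → ℂ) z = g n z := ae_all_iff.2 hg
  filter_upwards [hae, hall, ae_mem_ball_bergmanMeasure s] with z h1 h2 h3
  refine tendsto_nhds_unique h1 ?_
  simp only [h2]
  exact (hG z h3).comp hns.tendsto_atTop

/-- Completeness of `A²_s(D)`, so that it is a Hilbert space and operators on it have adjoints. -/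
instance completeSpace_bergmanSpace {s : ℝ} [hs : Fact (-1 < s)] :
    CompleteSpace (bergmanSpace s) :=
  (isClosed_bergmanSpace hs.out).completeSpace_coe

/-- A bounded operator on a Hilbert space is essentially normal if its self-commutator
`T* T - T T*` is compact. -/
def IsEssentiallyNormal {H : Type*} [NormedAddCommGroup H] [InnerProductSpace ℂ H]
    [CompleteSpace H] (T : H →L[ℂ] H) : Prop :=
  IsCompactOperator (ContinuousLinearMap.adjoint T ∘L T - T ∘L ContinuousLinearMap.adjoint T)

/-- `φ` restricts to an automorphism (biholomorphic self-map) of the open unit disk. -/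
def IsDiskAutomorphism (φ : ℂ → ℂ) : Prop :=
  DifferentiableOn ℂ φ (ball 0 1) ∧ MapsTo φ (ball 0 1) (ball 0 1) ∧
    ∃ ψ : ℂ → ℂ, DifferentiableOn ℂ ψ (ball 0 1) ∧ MapsTo ψ (ball 0 1) (ball 0 1) ∧
      InvOn ψ φ (ball 0 1) (ball 0 1)

/-- `φ` is a rotation `z ↦ c z`, `|c| = 1`, of the open unit disk. -/
def IsDiskRotation (φ : ℂ → ℂ) : Prop :=
  ∃ c : ℂ, ‖c‖ = 1 ∧ ∀ z ∈ ball (0 : ℂ) 1, φ z = c * z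

/-- The bounded operator `T` on `A²_s(D)` is the composition operator `C_φ f = f ∘ φ`: if the
holomorphic function `g` on the disk represents `f`, then `g ∘ φ` represents `T f`. -/
def IsCompositionOperator (s : ℝ) (φ : ℂ → ℂ) (T : bergmanSpace s →L[ℂ] bergmanSpace s) : Prop :=
  ∀ (f : bergmanSpace s) (g : ℂ → ℂ), IsHolomorphicRep s f g → IsHolomorphicRep s (T f) (g ∘ φ)

/-! Every disk automorphism is `φ = c τ_a`, where `|c| = 1` and `τ_a` is the involution exchanging
`0` and `a`; its inverse is `c̄ τ_{ca}`. Let `q_b = |τ_b'|`. Changing variables gives `‖C_φ f‖² = ∫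
|f|² q_{ca}^{s+2} dv_s`, and for the inverse `ψ` of `φ` likewise `‖C_ψ f‖² = ∫ |f|² q_a^{s+2} dv_s`.
The densities are bounded, hence both operators are.

Powers of a peak function, normalised, are unit vectors `e_n` concentrating at a boundary point `ζ`.
They are weakly null, `‖C_φ e_n‖²` tends to `q_{ca}(ζ)^{s+2}` and `‖C_ψ e_n‖²` to `q_a(ζ)^{s+2}`. If
`C_φ* C_φ - C_φ C_φ*` is compact, then along a subsequence `‖C_φ* e_n‖²` has the same limit as `‖C_φ
e_n‖²`. Since `C_φ C_ψ = 1`, also `1 = ⟪C_φ* e_n, C_ψ e_n⟫ ≤ ‖C_φ* e_n‖ ‖C_ψ e_n‖`, which forces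
`q_{ca}(ζ) q_a(ζ) ≥ 1` at every boundary point. For `a ≠ 0` the maximum modulus principle produces a
`ζ` that violates this (`exists_diskDilation_mul_lt_one`), so `a = 0` and `φ` is a rotation.
Conversely, for a rotation the density is `1`, so `C_φ` is an invertible isometry, hence normal. -/

/-- The involutive automorphism of the unit disk that exchanges `0` and `a`. -/
noncomputable def diskInvolution (a z : ℂ) : ℂ :=
  (a - z) / (1 - (starRingEnd ℂ) a * z)

/-- The absolute value of the derivative of `diskInvolution a`. -/
noncomputable def diskDilation (a z : ℂ) : ℝ :=
  (1 - ‖a‖ ^ 2) / ‖1 - (starRingEnd ℂ) a * z‖ ^ 2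

/-! ### Disk involutions and the classification of automorphisms -/

theorem one_sub_conj_mul_ne_zero {a z : ℂ} (ha : ‖a‖ < 1) (hz : ‖z‖ ≤ 1) :
    1 - (starRingEnd ℂ) a * z ≠ 0 := by
  intro h
  have h1 : ‖(starRingEnd ℂ) a * z‖ = 1 := by
    rw [← sub_eq_zero.1 h, norm_one]
  rw [norm_mul, RCLike.norm_conj] at h1
  nlinarith [norm_nonneg a, norm_nonneg z]

theorem diskDilation_pos {a z : ℂ} (ha : ‖a‖ < 1) (hz : ‖z‖ ≤ 1) : 0 < diskDilation a z := by
  have h1 := norm_pos_iff.2 (one_sub_conj_mul_ne_zero ha hz)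
  have h2 : 0 < 1 - ‖a‖ ^ 2 := by nlinarith [norm_nonneg a]
  unfold diskDilation
  positivity

theorem continuousOn_diskDilation {a : ℂ} (ha : ‖a‖ < 1) :
    ContinuousOn (diskDilation a) (closedBall 0 1) := by
  unfold diskDilation
  refine ContinuousOn.div (by fun_prop) (by fun_prop) fun z hz => ?_
  have := norm_pos_iff.2 (one_sub_conj_mul_ne_zero ha (by simpa using hz))
  positivity

/-- This comes from `|1 - āz|² - |a - z|² = (1 - |a|²)(1 - |z|²)`. The weight therefore scales by
the same factor `|τ_a'|` whose square is the Jacobian. -/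
theorem one_sub_norm_sq_diskInvolution {a z : ℂ} (ha : ‖a‖ < 1) (hz : ‖z‖ ≤ 1) :
    1 - ‖diskInvolution a z‖ ^ 2 = diskDilation a z * (1 - ‖z‖ ^ 2) := by
  have h1 := norm_pos_iff.2 (one_sub_conj_mul_ne_zero ha hz)
  have h2 : ‖1 - (starRingEnd ℂ) a * z‖ ^ 2 - ‖a - z‖ ^ 2 = (1 - ‖a‖ ^ 2) * (1 - ‖z‖ ^ 2) := by
    simp only [← Complex.normSq_eq_norm_sq, Complex.normSq_apply]
    simp
    ring
  rw [diskInvolution, diskDilation, norm_div, div_pow, div_mul_eq_mul_div, ← h2, sub_div,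
    div_self (by positivity)]

theorem norm_diskInvolution_lt_one {a z : ℂ} (ha : ‖a‖ < 1) (hz : ‖z‖ < 1) :
    ‖diskInvolution a z‖ < 1 := by
  have h1 := one_sub_norm_sq_diskInvolution ha hz.le
  have h2 := diskDilation_pos ha hz.le
  have h3 : 0 < 1 - ‖z‖ ^ 2 := by nlinarith [norm_nonneg z]
  have h4 := mul_pos h2 h3
  nlinarith [norm_nonneg (diskInvolution a z)]

theorem diskInvolution_diskInvolution {a z : ℂ} (ha : ‖a‖ < 1) (hz : ‖z‖ < 1) :
    diskInvolution a (diskInvolution a z) = z := by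
  have h1 := one_sub_conj_mul_ne_zero ha hz.le
  have h2 := one_sub_conj_mul_ne_zero ha (norm_diskInvolution_lt_one ha hz).le
  have h3 : diskInvolution a z * (1 - (starRingEnd ℂ) a * z) = a - z := div_mul_cancel₀ _ h1
  rw [diskInvolution, div_eq_iff h2]
  apply mul_right_cancel₀ h1
  linear_combination (-1 + (starRingEnd ℂ) a * z) * h3

theorem hasDerivAt_diskInvolution {a z : ℂ} (ha : ‖a‖ < 1) (hz : ‖z‖ < 1) :
    HasDerivAt (diskInvolution a)
      (-(1 - (starRingEnd ℂ) a * a) / (1 - (starRingEnd ℂ) a * z) ^ 2) z := by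
  have h1 := one_sub_conj_mul_ne_zero ha hz.le
  convert! ((hasDerivAt_id z).const_sub a).div
    (((hasDerivAt_id z).const_mul ((starRingEnd ℂ) a)).const_sub 1) h1 using 1
  simp
  ring

theorem norm_deriv_diskInvolution {a z : ℂ} (ha : ‖a‖ < 1) :
    ‖-(1 - (starRingEnd ℂ) a * a) / (1 - (starRingEnd ℂ) a * z) ^ 2‖ = diskDilation a z := by
  rw [diskDilation, norm_div, norm_neg, norm_pow]
  congr 1
  rw [← Complex.normSq_eq_conj_mul_self, Complex.normSq_eq_norm_sq, ← Complex.ofReal_one,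
    ← Complex.ofReal_sub, Complex.norm_real, Real.norm_of_nonneg]
  nlinarith [norm_nonneg a]

theorem differentiableOn_diskInvolution {a : ℂ} (ha : ‖a‖ < 1) :
    DifferentiableOn ℂ (diskInvolution a) (ball 0 1) := fun z hz =>
  (hasDerivAt_diskInvolution ha (by simpa using hz)).differentiableAt.differentiableWithinAt

theorem mapsTo_diskInvolution {a : ℂ} (ha : ‖a‖ < 1) :
    MapsTo (diskInvolution a) (ball 0 1) (ball 0 1) := fun z hz => by
  simpa using norm_diskInvolution_lt_one ha (by simpa using hz)

/-- The Schwarz lemma for `φ` and for its inverse forces `|φ(z)| = |z|`; a single point `z = 1/2`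
suffices for the equality case. -/
theorem IsDiskAutomorphism.isDiskRotation_of_map_zero {φ : ℂ → ℂ} (hφ : IsDiskAutomorphism φ)
    (h0 : φ 0 = 0) : IsDiskRotation φ := by
  obtain ⟨hd, hm, ψ, hd', hm', hinv⟩ := hφ
  have hψ0 : ψ 0 = 0 := by simpa [h0] using hinv.1 (mem_ball_self one_pos)
  have hz : (1 / 2 : ℂ) ∈ ball (0 : ℂ) 1 := by simp; norm_num
  have h1 : ‖φ (1 / 2)‖ ≤ ‖(1 / 2 : ℂ)‖ :=
    Complex.norm_le_norm_of_mapsTo_ball hd (hm.mono_right ball_subset_closedBall) h0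
      (by simpa using hz)
  have h2 : ‖(1 / 2 : ℂ)‖ ≤ ‖φ (1 / 2)‖ := by
    have := Complex.norm_le_norm_of_mapsTo_ball hd' (hm'.mono_right ball_subset_closedBall) hψ0
      (z := φ (1 / 2)) (by simpa using hm hz)
    rwa [hinv.1 hz] at this
  obtain ⟨c, hc, he⟩ := Complex.affine_of_mapsTo_ball_of_exists_norm_dslope_eq_div' hd
    (R₂ := 1) (by rw [h0]; exact hm.mono_right ball_subset_closedBall)
    ⟨1 / 2, hz, by
      rw [dslope_of_ne _ (by norm_num), slope_def_module, h0, sub_zero, sub_zero, norm_smul,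
        le_antisymm h1 h2]
      norm_num⟩
  refine ⟨c, by simpa using hc, fun z hz => ?_⟩
  rw [he hz, h0]
  simp [mul_comm]

/-- The automorphisms of the disk are the maps `c • diskInvolution a`. -/
theorem IsDiskAutomorphism.exists_eq_mul_diskInvolution {φ : ℂ → ℂ} (hφ : IsDiskAutomorphism φ) :
    ∃ a c : ℂ, ‖a‖ < 1 ∧ ‖c‖ = 1 ∧ ∀ z ∈ ball (0 : ℂ) 1, φ z = c * diskInvolution a z := by
  obtain ⟨hd, hm, ψ, hd', hm', hinv⟩ := hφ
  have h0 : (0 : ℂ) ∈ ball (0 : ℂ) 1 := mem_ball_self one_pos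
  -- The parameter is the zero `ψ 0` of `φ`: precomposing with its involution gives an automorphism
  -- fixing `0`, hence a rotation.
  have ha : ‖ψ 0‖ < 1 := by simpa using hm' h0
  have hτ := mapsTo_diskInvolution ha
  have hττ : ∀ z ∈ ball (0 : ℂ) 1, diskInvolution (ψ 0) (diskInvolution (ψ 0) z) = z :=
    fun z hz => diskInvolution_diskInvolution ha (by simpa using hz)
  have haut : IsDiskAutomorphism (φ ∘ diskInvolution (ψ 0)) := by
    refine ⟨hd.comp (differentiableOn_diskInvolution ha) hτ, hm.comp hτ,
      diskInvolution (ψ 0) ∘ ψ, (differentiableOn_diskInvolution ha).comp hd' hm', hτ.comp hm',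
      fun z hz => ?_, fun z hz => ?_⟩
    · simp only [Function.comp_apply]
      rw [hinv.1 (hτ hz), hττ z hz]
    · simp only [Function.comp_apply]
      rw [hττ _ (hm' hz), hinv.2 hz]
  obtain ⟨c, hc, he⟩ := haut.isDiskRotation_of_map_zero (by
    simp only [Function.comp_apply]
    rw [show diskInvolution (ψ 0) 0 = ψ 0 by simp [diskInvolution], hinv.2 h0])
  refine ⟨ψ 0, c, ha, hc, fun z hz => ?_⟩
  rw [← he _ (hτ hz), Function.comp_apply, hττ z hz]

/-- Since `τ_{ca}(c w) = c τ_a(w)`, the inverse of `c τ_a` has the same shape, with parameters `c̄`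
and `ca`. -/
theorem mul_diskInvolution_mul_diskInvolution {a c z : ℂ} (ha : ‖a‖ < 1) (hc : ‖c‖ = 1)
    (hz : ‖z‖ < 1) :
    (starRingEnd ℂ) c * diskInvolution (c * a) (c * diskInvolution a z) = z := by
  have hcc : (starRingEnd ℂ) c * c = 1 := by
    rw [← Complex.normSq_eq_conj_mul_self, Complex.normSq_eq_norm_sq, hc]; simp
  have h : ∀ w, diskInvolution (c * a) (c * w) = c * diskInvolution a w := by
    intro w
    rw [diskInvolution, diskInvolution, mul_div_assoc', ← mul_sub, map_mul]
    congr 2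
    linear_combination (starRingEnd ℂ) a * w * hcc
  rw [h, ← mul_assoc, hcc, one_mul, diskInvolution_diskInvolution ha hz]

/-- For `‖a‖ = ‖b‖` in `(0, 1)`, the product of the dilations at `a` and `b` is below `1` at some
boundary point. -/
theorem exists_diskDilation_mul_lt_one {a b : ℂ} (ha0 : a ≠ 0) (ha : ‖a‖ < 1) (hab : ‖b‖ = ‖a‖) :
    ∃ ζ : ℂ, ‖ζ‖ = 1 ∧ diskDilation b ζ * diskDilation a ζ < 1 := by
  -- The polynomial `P(z) = (1 - āz)(1 - b̄z)` has `P(0) = 1`, so `|P| ≥ 1` at a boundary maximum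
  -- `ζ`. There the product of dilations is `(1 - |a|²)² / |P(ζ)|² < 1`.
  have hd : DiffContOnCl ℂ
      (fun z => (1 - (starRingEnd ℂ) a * z) * (1 - (starRingEnd ℂ) b * z)) (ball (0 : ℂ) 1) :=
    Differentiable.diffContOnCl (by fun_prop)
  obtain ⟨ζ, hζ, hmax⟩ := Complex.exists_mem_frontier_isMaxOn_norm isBounded_ball
    ⟨0, mem_ball_self one_pos⟩ hd
  rw [frontier_ball _ one_ne_zero, mem_sphere_zero_iff_norm] at hζ
  have h := hmax (subset_closure (mem_ball_self one_pos))
  simp only [mem_ofPred_eq, Function.comp_apply, mul_zero, sub_zero, mul_one, norm_one,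
    norm_mul] at h
  refine ⟨ζ, hζ, ?_⟩
  have hapos := norm_pos_iff.2 ha0
  rw [diskDilation, diskDilation, hab, div_mul_div_comm, div_lt_one (by
    have h1 := norm_pos_iff.2 (one_sub_conj_mul_ne_zero ha hζ.le)
    have h2 := norm_pos_iff.2 (one_sub_conj_mul_ne_zero (hab.trans_lt ha) hζ.le)
    positivity), ← mul_pow, mul_comm ‖1 - (starRingEnd ℂ) b * ζ‖]
  have : (1 - ‖a‖ ^ 2) * (1 - ‖a‖ ^ 2) < 1 := by
    have h1 : 0 < ‖a‖ ^ 2 := by positivity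
    have h2 : ‖a‖ ^ 2 < 1 := by nlinarith
    nlinarith
  nlinarith

/-! ### Change of variables and finiteness of `dv_s` -/

/-- Change of variables for a holomorphic bijection of a measurable set. -/
theorem lintegral_image_eq_lintegral_norm_deriv_sq_mul {S : Set ℂ} (hS : MeasurableSet S)
    {f f' : ℂ → ℂ} (hf : ∀ z ∈ S, HasDerivAt f (f' z) z) (hinj : InjOn f S) (H : ℂ → ℝ≥0∞) :
    ∫⁻ z in f '' S, H z = ∫⁻ z in S, ENNReal.ofReal (‖f' z‖ ^ 2) * H (f z) := by
  rw [lintegral_image_eq_lintegral_abs_det_fderiv_mul volume hS (fun z hz =>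
    ((hf z hz).hasFDerivAt.restrictScalars ℝ).hasFDerivWithinAt) hinj]
  refine setLIntegral_congr_fun hS fun z _ => ?_
  have : |(ContinuousLinearMap.restrictScalars ℝ
      (ContinuousLinearMap.toSpanSingleton ℂ (f' z))).det| = ‖f' z‖ ^ 2 := by
    simp [ContinuousLinearMap.det, LinearMap.det_restrictScalars, Algebra.norm_complex_eq,
      Complex.normSq_eq_norm_sq]
  simp only [this]

theorem lintegral_bergmanMeasure (s : ℝ) (H : ℂ → ℝ≥0∞) :
    ∫⁻ z, H z ∂bergmanMeasure s = ∫⁻ z in ball (0 : ℂ) 1,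
      ENNReal.ofReal ((s + 1) / Real.pi * (1 - ‖z‖ ^ 2) ^ s) * H z := by
  rw [bergmanMeasure, lintegral_withDensity_eq_lintegral_mul_non_measurable]
  · rfl
  · fun_prop
  · exact Eventually.of_forall fun _ => ENNReal.ofReal_lt_top

/-- How `dv_s` transforms under a disk automorphism. -/
theorem lintegral_comp_mul_diskInvolution (s : ℝ) {a c : ℂ} (ha : ‖a‖ < 1) (hc : ‖c‖ = 1)
    (H : ℂ → ℝ≥0∞) :
    ∫⁻ z, H (c * diskInvolution a z) ∂bergmanMeasure s =
      ∫⁻ z, H z * ENNReal.ofReal (diskDilation (c * a) z ^ (s + 2)) ∂bergmanMeasure s := by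
  have hb : ‖c * a‖ < 1 := by rwa [norm_mul, hc, one_mul]
  have hc' : ‖(starRingEnd ℂ) c‖ = 1 := by rwa [RCLike.norm_conj]
  have hcc : (starRingEnd ℂ) c * c = 1 := by
    rw [← Complex.normSq_eq_conj_mul_self, Complex.normSq_eq_norm_sq, hc]; simp
  -- The substitution is by the inverse map, which is why the dilation is taken at `c * a` rather
  -- than at `a`.
  set ψ : ℂ → ℂ := fun u => (starRingEnd ℂ) c * diskInvolution (c * a) u with hψ
  have hφψ : ∀ u ∈ ball (0 : ℂ) 1, c * diskInvolution a (ψ u) = u := by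
    intro u hu
    have := mul_diskInvolution_mul_diskInvolution hb hc' (by simpa using hu)
    rwa [Complex.conj_conj, ← mul_assoc, hcc, one_mul] at this
  have hψm : MapsTo ψ (ball 0 1) (ball 0 1) := by
    intro u hu
    rw [mem_ball_zero_iff, hψ, norm_mul, hc', one_mul]
    exact norm_diskInvolution_lt_one hb (by simpa using hu)
  have himg : ψ '' ball 0 1 = ball 0 1 := by
    refine hψm.image_subset.antisymm fun z hz => ⟨c * diskInvolution a z, ?_, ?_⟩
    · rw [mem_ball_zero_iff, norm_mul, hc, one_mul]
      exact norm_diskInvolution_lt_one ha (by simpa using hz)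
    · exact mul_diskInvolution_mul_diskInvolution ha hc (by simpa using hz)
  have hinj : InjOn ψ (ball 0 1) := fun u hu v hv h => by rw [← hφψ u hu, h, hφψ v hv]
  rw [lintegral_bergmanMeasure, lintegral_bergmanMeasure]
  nth_rw 1 [← himg]
  rw [lintegral_image_eq_lintegral_norm_deriv_sq_mul measurableSet_ball (fun u hu =>
    (hasDerivAt_diskInvolution hb (by simpa using hu)).const_mul ((starRingEnd ℂ) c)) hinj]
  refine setLIntegral_congr_fun measurableSet_ball fun u hu => ?_
  have hu1 : ‖u‖ < 1 := by simpa using hu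
  have hq := diskDilation_pos hb hu1.le
  have hpos : 0 < 1 - ‖u‖ ^ 2 := by nlinarith [norm_nonneg u]
  have h1 : 1 - ‖ψ u‖ ^ 2 = diskDilation (c * a) u * (1 - ‖u‖ ^ 2) := by
    rw [hψ, norm_mul, hc', one_mul, one_sub_norm_sq_diskInvolution hb hu1.le]
  -- The exponent `s + 2` collects `s` from the weight and `2` from the Jacobian.
  rw [hφψ u hu, h1, norm_mul, hc', one_mul, norm_deriv_diskInvolution hb,
    Real.mul_rpow hq.le hpos.le, Real.rpow_add hq, mul_comm (H u),
    ← mul_assoc (ENNReal.ofReal _) (ENNReal.ofReal _), ← mul_assoc (ENNReal.ofReal _)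
      (ENNReal.ofReal _), ← ENNReal.ofReal_mul (by positivity), ← ENNReal.ofReal_mul' (by positivity)]
  congr 2
  rw [Real.rpow_two]
  ring

/-- In polar coordinates `(1 - r²)^s = (1 + r)^s (1 - r)^s`; only the last factor can be singular,
and it is integrable at `1` because `s > -1`. -/
theorem isFiniteMeasure_bergmanMeasure {s : ℝ} (hs : -1 < s) :
    IsFiniteMeasure (bergmanMeasure s) := by
  have h1 : IntegrableOn (fun r : ℝ => (1 - r) ^ s) (Ioo 0 1) := by
    have := (intervalIntegral.intervalIntegrable_rpow' (a := 0) (b := 1) hs).comp_sub_left 1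
    simp only [sub_zero, sub_self] at this
    rw [← integrableOn_Ioc_iff_integrableOn_Ioo,
      ← intervalIntegrable_iff_integrableOn_Ioc_of_le zero_le_one]
    exact this.symm
  have h2 : IntegrableOn (fun r : ℝ => r ^ 1 • ((s + 1) / Real.pi * (1 - r ^ 2) ^ s))
      (Ioo 0 1) := by
    have h3 : IntegrableOn (fun r : ℝ => (r * ((s + 1) / Real.pi) * (1 + r) ^ s) * (1 - r) ^ s)
        (Ioo 0 1) := by
      refine IntegrableOn.continuousOn_mul_of_subset (K := Icc 0 1) ?_ h1 isCompact_Icc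
        measurableSet_Ioo Ioo_subset_Icc_self
      refine ContinuousOn.mul (by fun_prop) (ContinuousOn.rpow_const (by fun_prop) ?_)
      intro r hr
      left
      linarith [hr.1]
    refine h3.congr_fun (fun r hr => ?_) measurableSet_Ioo
    have h5 : (1 : ℝ) - r ^ 2 = (1 + r) * (1 - r) := by ring
    simp only [smul_eq_mul, pow_one]
    rw [h5, Real.mul_rpow (by linarith [hr.1]) (by linarith [hr.2])]
    ring
  have h4 : IntegrableOn (fun z : ℂ => (s + 1) / Real.pi * (1 - ‖z‖ ^ 2) ^ s) (ball 0 1) := by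
    refine (integrableOn_fun_norm_addHaar volume
      (f := fun r : ℝ => (s + 1) / Real.pi * (1 - r ^ 2) ^ s)).2 ?_
    simpa [Complex.finrank_real_complex] using h2
  exact isFiniteMeasure_withDensity_ofReal h4.2

/-! ### Holomorphic representatives and norms -/

theorem IsHolomorphicRep.eqOn {s : ℝ} (hs : -1 < s) {f : Lp ℂ 2 (bergmanMeasure s)} {g h : ℂ → ℂ}
    (hg : IsHolomorphicRep s f g) (hh : IsHolomorphicRep s f h) : EqOn g h (ball 0 1) := by
  intro z hz
  obtain ⟨C, hC, hb⟩ := exists_enorm_le_eLpNorm hs (R := ‖z‖) (by simpa using hz)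
  have h1 := hb (g - h) (hg.1.sub hh.1) z (by simp)
  have h2 : g - h =ᵐ[bergmanMeasure s] 0 := by
    filter_upwards [hg.2, hh.2] with w h1 h2
    simp [← h1, ← h2]
  rw [eLpNorm_congr_ae h2, eLpNorm_zero, mul_zero, nonpos_iff_eq_zero, enorm_eq_zero] at h1
  exact sub_eq_zero.1 h1

theorem aestronglyMeasurable_bergmanMeasure {s : ℝ} {g : ℂ → ℂ}
    (hg : DifferentiableOn ℂ g (ball 0 1)) : AEStronglyMeasurable g (bergmanMeasure s) :=
  (hg.continuousOn.aestronglyMeasurable measurableSet_ball).mono_ac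
    (withDensity_absolutelyContinuous _ _)

theorem eLpNorm_two_sq {α E : Type*} [MeasurableSpace α] [NormedAddCommGroup E] (μ : Measure α)
    (g : α → E) : eLpNorm g 2 μ ^ 2 = ∫⁻ z, ‖g z‖ₑ ^ 2 ∂μ := by
  rw [eLpNorm_eq_lintegral_rpow_enorm_toReal (by norm_num) (by norm_num), ← ENNReal.rpow_natCast,
    ← ENNReal.rpow_mul]
  norm_num

namespace IsHolomorphicRep

variable {s : ℝ} {f f₁ f₂ : Lp ℂ 2 (bergmanMeasure s)} {g g₁ g₂ : ℂ → ℂ}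

theorem add (h₁ : IsHolomorphicRep s f₁ g₁) (h₂ : IsHolomorphicRep s f₂ g₂) :
    IsHolomorphicRep s (f₁ + f₂) (g₁ + g₂) :=
  ⟨h₁.1.add h₂.1, (Lp.coeFn_add f₁ f₂).trans (h₁.2.add h₂.2)⟩

theorem const_smul (c : ℂ) (h : IsHolomorphicRep s f g) : IsHolomorphicRep s (c • f) (c • g) :=
  ⟨h.1.const_smul c, (Lp.coeFn_smul c f).trans (h.2.const_smul c)⟩

theorem unique (h₁ : IsHolomorphicRep s f₁ g) (h₂ : IsHolomorphicRep s f₂ g) : f₁ = f₂ :=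
  Lp.ext (h₁.2.trans h₂.2.symm)

theorem congr (h₁ : IsHolomorphicRep s f g₁) (he : EqOn g₂ g₁ (ball 0 1)) :
    IsHolomorphicRep s f g₂ := by
  refine ⟨h₁.1.congr he, h₁.2.trans ?_⟩
  filter_upwards [ae_mem_ball_bergmanMeasure s] with z hz
  exact (he hz).symm

theorem ofReal_norm_sq (h : IsHolomorphicRep s f g) :
    ENNReal.ofReal (‖f‖ ^ 2) = ∫⁻ z, ‖g z‖ₑ ^ 2 ∂bergmanMeasure s := by
  rw [← eLpNorm_two_sq, ← eLpNorm_congr_ae h.2, ENNReal.ofReal_pow (norm_nonneg _), ofReal_norm,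
    Lp.enorm_def]

theorem norm_sq_eq_integral (h : IsHolomorphicRep s f g) :
    ‖f‖ ^ 2 = ∫ z, ‖g z‖ ^ 2 ∂bergmanMeasure s := by
  rw [integral_eq_lintegral_of_nonneg_ae (Eventually.of_forall fun z => sq_nonneg ‖g z‖)
    ((aestronglyMeasurable_bergmanMeasure h.1).norm.pow 2),
    ← ENNReal.toReal_ofReal (sq_nonneg ‖f‖), h.ofReal_norm_sq]
  congr 1
  refine lintegral_congr fun z => ?_
  rw [ENNReal.ofReal_pow (norm_nonneg _), ofReal_norm]

end IsHolomorphicRep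

/-! ### Composition operators: existence, uniqueness, norm formula -/

theorem IsCompositionOperator.ext {s : ℝ} {φ : ℂ → ℂ} {T T' : bergmanSpace s →L[ℂ] bergmanSpace s}
    (hT : IsCompositionOperator s φ T) (hT' : IsCompositionOperator s φ T') : T = T' := by
  ext1 f
  obtain ⟨g, hg⟩ := f.2
  exact Subtype.ext ((hT f g hg).unique (hT' f g hg))

/-- A holomorphic self-map of the disk under which `dv_s` is pushed to at most a multiple of itself
induces a bounded composition operator. -/
theorem exists_isCompositionOperator {s : ℝ} (hs : -1 < s) {φ : ℂ → ℂ}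
    (hd : DifferentiableOn ℂ φ (ball 0 1)) (hm : MapsTo φ (ball 0 1) (ball 0 1)) {K : ℝ}
    (hK : 0 ≤ K) (hle : ∀ H : ℂ → ℝ≥0∞, ∫⁻ z, H (φ z) ∂bergmanMeasure s
      ≤ ENNReal.ofReal K * ∫⁻ z, H z ∂bergmanMeasure s) :
    ∃ T : bergmanSpace s →L[ℂ] bergmanSpace s, IsCompositionOperator s φ T := by
  have hex : ∀ f : bergmanSpace s, ∃ f' : bergmanSpace s, ∀ g, IsHolomorphicRep s f g →
      IsHolomorphicRep s f' (g ∘ φ) := by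
    rintro ⟨f, g₀, hg₀⟩
    have hdiff : DifferentiableOn ℂ (g₀ ∘ φ) (ball 0 1) := hg₀.1.comp hd hm
    have hmem : MemLp (g₀ ∘ φ) 2 (bergmanMeasure s) := by
      refine ⟨aestronglyMeasurable_bergmanMeasure hdiff, ?_⟩
      have h1 : eLpNorm (g₀ ∘ φ) 2 (bergmanMeasure s) ^ 2 < ∞ := by
        rw [eLpNorm_two_sq]
        refine (hle fun z => ‖g₀ z‖ₑ ^ 2).trans_lt ?_
        rw [← hg₀.ofReal_norm_sq, ← ENNReal.ofReal_mul hK]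
        exact ENNReal.ofReal_lt_top
      simpa [ENNReal.pow_lt_top_iff] using h1
    have hrep : IsHolomorphicRep s hmem.toLp (g₀ ∘ φ) := ⟨hdiff, hmem.coeFn_toLp⟩
    -- Representatives agree on the disk and `φ` maps into it, so the chosen `g₀` settles every `g`.
    exact ⟨⟨hmem.toLp, g₀ ∘ φ, hrep⟩, fun g hg => hrep.congr fun z hz => hg.eqOn hs hg₀ (hm hz)⟩
  choose F hF using hex
  let L : bergmanSpace s →ₗ[ℂ] bergmanSpace s :=
    { toFun := F
      map_add' := by
        intro f₁ f₂
        obtain ⟨g₁, h₁⟩ := f₁.2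
        obtain ⟨g₂, h₂⟩ := f₂.2
        exact Subtype.ext ((hF (f₁ + f₂) _ (h₁.add h₂)).unique ((hF f₁ _ h₁).add (hF f₂ _ h₂)))
      map_smul' := by
        intro c f
        obtain ⟨g, h⟩ := f.2
        exact Subtype.ext ((hF (c • f) _ (h.const_smul c)).unique ((hF f _ h).const_smul c)) }
  refine ⟨L.mkContinuous (Real.sqrt K) fun f => ?_, hF⟩
  obtain ⟨g, h⟩ := f.2
  have h1 := hle fun z => ‖g z‖ₑ ^ 2
  rw [← h.ofReal_norm_sq, ← ENNReal.ofReal_mul hK] at h1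
  have h2 := (hF f g h).ofReal_norm_sq
  simp only [Function.comp_apply] at h2
  rw [← h2, ENNReal.ofReal_le_ofReal_iff (by positivity)] at h1
  rw [← Real.sqrt_sq (norm_nonneg f), ← Real.sqrt_mul hK]
  exact Real.le_sqrt_of_sq_le h1

section Automorphism

variable {s : ℝ} {a c : ℂ} {φ : ℂ → ℂ}

theorem lintegral_comp_of_eqOn_diskInvolution (ha : ‖a‖ < 1) (hc : ‖c‖ = 1)
    (hφ : ∀ z ∈ ball (0 : ℂ) 1, φ z = c * diskInvolution a z) (H : ℂ → ℝ≥0∞) :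
    ∫⁻ z, H (φ z) ∂bergmanMeasure s =
      ∫⁻ z, H z * ENNReal.ofReal (diskDilation (c * a) z ^ (s + 2)) ∂bergmanMeasure s := by
  rw [← lintegral_comp_mul_diskInvolution s ha hc]
  refine lintegral_congr_ae ?_
  filter_upwards [ae_mem_ball_bergmanMeasure s] with z hz
  rw [hφ z hz]

theorem continuousOn_diskDilation_rpow (ha : ‖a‖ < 1) :
    ContinuousOn (fun z => diskDilation a z ^ (s + 2)) (closedBall 0 1) :=
  (continuousOn_diskDilation ha).rpow_const fun z hz =>
    Or.inl (diskDilation_pos ha (by simpa using hz)).ne'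

theorem exists_isCompositionOperator_of_eqOn_diskInvolution (hs : -1 < s) (ha : ‖a‖ < 1)
    (hc : ‖c‖ = 1) (hφ : ∀ z ∈ ball (0 : ℂ) 1, φ z = c * diskInvolution a z) :
    ∃ T : bergmanSpace s →L[ℂ] bergmanSpace s, IsCompositionOperator s φ T := by
  have hb : ‖c * a‖ < 1 := by rwa [norm_mul, hc, one_mul]
  obtain ⟨K, hK⟩ := (isCompact_closedBall (0 : ℂ) 1).bddAbove_image
    (continuousOn_diskDilation_rpow (s := s) hb)
  refine exists_isCompositionOperator hs (K := max K 0)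
    (((differentiableOn_diskInvolution ha).const_mul c).congr hφ) (fun z hz => ?_)
    (le_max_right _ _) fun H => ?_
  · rw [hφ z hz, mem_ball_zero_iff, norm_mul, hc, one_mul]
    exact norm_diskInvolution_lt_one ha (by simpa using hz)
  · rw [lintegral_comp_of_eqOn_diskInvolution ha hc hφ,
      ← lintegral_const_mul' _ _ ENNReal.ofReal_ne_top]
    refine lintegral_mono_ae ?_
    filter_upwards [ae_mem_ball_bergmanMeasure s] with z hz
    rw [mul_comm]
    gcongr
    exact (hK (mem_image_of_mem _ (ball_subset_closedBall hz))).trans (le_max_left _ _)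

/-- This turns limits of `‖T e_n‖²` along concentrating vectors into boundary values of the
dilation. -/
theorem IsCompositionOperator.norm_sq_eq_integral (ha : ‖a‖ < 1) (hc : ‖c‖ = 1)
    (hφ : ∀ z ∈ ball (0 : ℂ) 1, φ z = c * diskInvolution a z)
    {T : bergmanSpace s →L[ℂ] bergmanSpace s} (hT : IsCompositionOperator s φ T)
    {f : bergmanSpace s} {g : ℂ → ℂ} (hg : IsHolomorphicRep s f g) :
    ‖T f‖ ^ 2 = ∫ z, ‖g z‖ ^ 2 * diskDilation (c * a) z ^ (s + 2) ∂bergmanMeasure s := by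
  have hb : ‖c * a‖ < 1 := by rwa [norm_mul, hc, one_mul]
  have h := (hT f g hg).ofReal_norm_sq
  simp only [Function.comp_apply] at h
  rw [lintegral_comp_of_eqOn_diskInvolution ha hc hφ fun z => ‖g z‖ₑ ^ 2] at h
  have hnn : 0 ≤ᵐ[bergmanMeasure s] fun z => ‖g z‖ ^ 2 * diskDilation (c * a) z ^ (s + 2) := by
    filter_upwards [ae_mem_ball_bergmanMeasure s] with z hz
    have := diskDilation_pos hb (z := z) (by simpa using (ball_subset_closedBall hz))
    simp only [Pi.zero_apply]
    positivity
  rw [integral_eq_lintegral_of_nonneg_ae hnn, ← ENNReal.toReal_ofReal (sq_nonneg ‖T f‖)]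
  · congr 1
    refine h.trans (lintegral_congr fun z => ?_)
    rw [ENNReal.ofReal_mul (by positivity), ENNReal.ofReal_pow (norm_nonneg _), ofReal_norm]
  · refine (((aestronglyMeasurable_bergmanMeasure hg.1).norm).pow 2).mul ?_
    refine (ContinuousOn.aestronglyMeasurable (ContinuousOn.mono
      (continuousOn_diskDilation_rpow hb) ball_subset_closedBall) measurableSet_ball).mono_ac
      (withDensity_absolutelyContinuous _ _)

end Automorphism

/-! ### Essential normality in an abstract Hilbert space -/

/-- If `T` is essentially normal and `T S = 1`, then along a weakly null sequence of unit vectors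
the limits of `‖T e‖²` and `‖S e‖²` have product at least `1`: compactness of the self-commutator
replaces `‖T e‖` by `‖T* e‖`, and `⟪T* e, S e⟫ = 1`. -/
theorem IsEssentiallyNormal.one_le_mul_of_tendsto {H : Type*} [NormedAddCommGroup H]
    [InnerProductSpace ℂ H] [CompleteSpace H] {T S : H →L[ℂ] H} (hT : IsEssentiallyNormal T)
    (hTS : ∀ x, T (S x) = x) {e : ℕ → H} (he : ∀ n, ‖e n‖ = 1)
    (hweak : ∀ y, Tendsto (fun n => inner ℂ y (e n)) atTop (𝓝 0)) {α β : ℝ}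
    (hα : Tendsto (fun n => ‖T (e n)‖ ^ 2) atTop (𝓝 α))
    (hβ : Tendsto (fun n => ‖S (e n)‖ ^ 2) atTop (𝓝 β)) : 1 ≤ α * β := by
  set A := ContinuousLinearMap.adjoint T with hA
  set K := A ∘L T - T ∘L A with hK
  obtain ⟨C, hC, hsub⟩ := IsCompactOperator.image_closedBall_subset_compact
    (f := (K : H →ₗ[ℂ] H)) hT 1
  have hmem : ∀ n, K (e n) ∈ C := fun n => hsub ⟨e n, by simp [he n], rfl⟩
  obtain ⟨y, -, ns, hns, hy⟩ := hC.tendsto_subseq hmem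
  have h1 : Tendsto (fun k => inner ℂ (K (e (ns k))) (e (ns k))) atTop (𝓝 0) := by
    -- Split `⟪K e, e⟫ = ⟪K e - y, e⟫ + ⟪y, e⟫`: the first term vanishes by norm convergence of `K
    -- e` to `y`, the second by weak nullness.
    have h2 : Tendsto (fun k => inner ℂ (K (e (ns k)) - y) (e (ns k))) atTop (𝓝 0) := by
      refine squeeze_zero_norm (fun k => norm_inner_le_norm _ _) ?_
      simp only [he, mul_one]
      exact tendsto_iff_norm_sub_tendsto_zero.1 hy
    have h3 := h2.add ((hweak y).comp hns.tendsto_atTop)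
    simp only [Function.comp_def, ← inner_add_left, sub_add_cancel, add_zero] at h3
    exact h3
  have h4 : ∀ x, inner ℂ (K x) x = ((‖T x‖ ^ 2 - ‖A x‖ ^ 2 : ℝ) : ℂ) := by
    intro x
    rw [hK, sub_apply, inner_sub_left, ContinuousLinearMap.comp_apply,
      ContinuousLinearMap.comp_apply, hA, ContinuousLinearMap.adjoint_inner_left,
      ← ContinuousLinearMap.adjoint_inner_right T (ContinuousLinearMap.adjoint T x) x,
      inner_self_eq_norm_sq_to_K, inner_self_eq_norm_sq_to_K]
    simp
  have h5 : Tendsto (fun k => ‖A (e (ns k))‖ ^ 2) atTop (𝓝 α) := by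
    have h6 := (Complex.continuous_re.tendsto 0).comp h1
    simp only [Function.comp_def, h4, Complex.ofReal_re, Complex.zero_re] at h6
    have h7 := (hα.comp hns.tendsto_atTop).sub h6
    simpa [Function.comp_def] using h7
  refine ge_of_tendsto' (h5.mul (hβ.comp hns.tendsto_atTop)) fun k => ?_
  have h8 : inner ℂ (A (e (ns k))) (S (e (ns k))) = 1 := by
    rw [hA, ContinuousLinearMap.adjoint_inner_left, hTS, inner_self_eq_norm_sq_to_K, he]
    simp
  have h9 := norm_inner_le_norm (𝕜 := ℂ) (A (e (ns k))) (S (e (ns k)))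
  rw [h8, norm_one] at h9
  rw [Function.comp_apply, ← mul_pow]
  exact one_le_pow₀ h9

/-- Evaluating `T* T = 1` at `S x` gives `T* = S`, so `T T* = 1` as well and the self-commutator is
zero. -/
theorem isEssentiallyNormal_of_isometry {H : Type*} [NormedAddCommGroup H]
    [InnerProductSpace ℂ H] [CompleteSpace H] {T S : H →L[ℂ] H} (hTS : ∀ x, T (S x) = x)
    (hT : ∀ x, ‖T x‖ = ‖x‖) : IsEssentiallyNormal T := by
  have h1 := T.norm_map_iff_adjoint_comp_self.1 hT
  have h2 : ContinuousLinearMap.adjoint T = S := by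
    ext x
    have := congrArg (fun L : H →L[ℂ] H => L (S x)) h1
    simpa [hTS] using this
  have h3 : T ∘L ContinuousLinearMap.adjoint T = 1 := by
    ext x
    simp [h2, hTS]
  rw [IsEssentiallyNormal, h1, h3, sub_self]
  exact isCompactOperator_zero

/-! ### Concentrating sequences and weak convergence -/

/-- Unit vectors of `L²` whose mass concentrates at a null point converge weakly to zero. -/
theorem tendsto_inner_zero_of_concentrating {X : Type*} [MetricSpace X] [MeasurableSpace X]
    [BorelSpace X] {μ : Measure X} {x : X} (hx : μ {x} = 0) {e : ℕ → Lp ℂ 2 μ}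
    (he : ∀ n, ‖e n‖ = 1)
    (hc : ∀ ε > 0, Tendsto (fun n => ∫ z in (ball x ε)ᶜ, ‖e n z‖ ^ 2 ∂μ) atTop (𝓝 0))
    (y : Lp ℂ 2 μ) : Tendsto (fun n => inner ℂ y (e n)) atTop (𝓝 0) := by
  have hint : ∀ f : Lp ℂ 2 μ, Integrable (fun z => ‖f z‖ ^ 2) μ := fun f =>
    (memLp_two_iff_integrable_sq_norm (Lp.aestronglyMeasurable f)).1 (Lp.memLp f)
  have hnorm : ∀ f : Lp ℂ 2 μ, ∫ z, ‖f z‖ ^ 2 ∂μ = ‖f‖ ^ 2 := by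
    intro f
    have h1 : inner ℂ f f = ((∫ z, ‖f z‖ ^ 2 ∂μ : ℝ) : ℂ) := by
      rw [L2.inner_def, ← integral_complex_ofReal]
      refine integral_congr_ae (Eventually.of_forall fun z => ?_)
      simp [inner_self_eq_norm_sq_to_K]
    rw [inner_self_eq_norm_sq_to_K] at h1
    have h2 : ((‖f‖ : ℝ) : ℂ) ^ 2 = ((∫ z, ‖f z‖ ^ 2 ∂μ : ℝ) : ℂ) := h1
    exact_mod_cast h2.symm
  -- Young's inequality with parameter `δ`: the large coefficient `1/(2δ)` goes to `y` inside the
  -- ball and to `e n` outside, each of which has small mass there.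
  have hbound : ∀ δ > 0, ∀ ε > 0, ∀ n, ‖inner ℂ y (e n)‖ ≤ δ / 2 * (1 + ‖y‖ ^ 2) +
      1 / (2 * δ) * (∫ z in ball x ε, ‖y z‖ ^ 2 ∂μ + ∫ z in (ball x ε)ᶜ, ‖e n z‖ ^ 2 ∂μ) := by
    intro δ hδ ε hε n
    have hU : MeasurableSet (ball x ε) := measurableSet_ball
    have i1 := ((hint (e n)).add (hint y)).const_mul (δ / 2)
    have i2 := (((hint y).indicator hU).add ((hint (e n)).indicator hU.compl)).const_mul
      (1 / (2 * δ))
    have h1 := norm_integral_le_of_norm_le (f := fun z => inner ℂ (y z) (e n z)) (i1.add i2)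
      (Eventually.of_forall fun z => by
        refine (norm_inner_le_norm _ _).trans ?_
        have hδ' : 1 / (2 * δ) = δ⁻¹ / 2 := by field_simp
        have hδ2 : δ * δ⁻¹ = 1 := mul_inv_cancel₀ hδ.ne'
        have hδ3 : 0 < δ⁻¹ := inv_pos.2 hδ
        by_cases hz : z ∈ ball x ε
        · simp only [Pi.add_apply, indicator_of_mem hz,
            indicator_of_notMem (notMem_compl_iff.2 hz), hδ']
          nlinarith [mul_nonneg hδ.le (sq_nonneg (‖e n z‖ - δ⁻¹ * ‖y z‖)),
            mul_nonneg hδ.le (sq_nonneg ‖y z‖)]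
        · simp only [Pi.add_apply, indicator_of_notMem hz,
            indicator_of_mem (mem_compl hz), hδ']
          nlinarith [mul_nonneg hδ.le (sq_nonneg (‖y z‖ - δ⁻¹ * ‖e n z‖)),
            mul_nonneg hδ.le (sq_nonneg ‖e n z‖)])
    rw [← L2.inner_def] at h1
    refine h1.trans (le_of_eq ?_)
    rw [integral_add' i1 i2, integral_const_mul, integral_const_mul,
      integral_add' (hint _) (hint _), integral_add' ((hint y).indicator hU)
      ((hint (e n)).indicator hU.compl), integral_indicator hU, integral_indicator hU.compl,
      hnorm, hnorm, he]
    norm_num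
  have hsmall : Tendsto (fun k : ℕ => ∫ z in ball x (1 / ((k : ℝ) + 1)), ‖y z‖ ^ 2 ∂μ) atTop
      (𝓝 0) := by
    have h1 := tendsto_setIntegral_of_antitone (μ := μ)
      (s := fun k : ℕ => ball x (1 / ((k : ℝ) + 1))) (f := fun z => ‖y z‖ ^ 2)
      (fun _ => measurableSet_ball)
      (fun i j hij => ball_subset_ball (one_div_le_one_div_of_le (by positivity)
        (by exact_mod_cast Nat.succ_le_succ hij))) ⟨0, (hint y).integrableOn⟩
    have h2 : ⋂ k : ℕ, ball x (1 / ((k : ℝ) + 1)) ⊆ {x} := by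
      intro z hz
      rw [mem_singleton_iff]
      by_contra hne
      obtain ⟨k, hk⟩ := exists_nat_one_div_lt (dist_pos.2 hne)
      exact absurd (mem_ball.1 (mem_iInter.1 hz k)) (not_lt.2 hk.le)
    rwa [setIntegral_measure_zero _ (measure_mono_null h2 hx)] at h1
  rw [Metric.tendsto_atTop]
  intro η hη
  simp only [dist_zero_right]
  -- This `δ` makes the first term of `hbound` equal to `η/4`; two masses below `ηδ/4` then keep the
  -- second below `η/4`.
  set δ : ℝ := η / (2 * (1 + ‖y‖ ^ 2)) with hδdef
  have hy0 : 0 < 1 + ‖y‖ ^ 2 := by positivity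
  have hδ : 0 < δ := by positivity
  have hη' : 0 < η * δ / 4 := by positivity
  obtain ⟨k, hk⟩ := (hsmall.eventually (gt_mem_nhds hη')).exists
  have hk0 : (0 : ℝ) < 1 / ((k : ℝ) + 1) := by positivity
  obtain ⟨N, hN⟩ := eventually_atTop.1 ((hc _ hk0).eventually (gt_mem_nhds hη'))
  refine ⟨N, fun n hn => (hbound δ hδ _ hk0 n).trans_lt ?_⟩
  have h1 := hN n hn
  have h2 : δ / 2 * (1 + ‖y‖ ^ 2) = η / 4 := by rw [hδdef]; field_simp; norm_num
  calc _ < η / 4 + 1 / (2 * δ) * (η * δ / 4 + η * δ / 4) := by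
        rw [h2]
        gcongr
    _ = η / 2 := by field_simp; norm_num
    _ < η := by linarith

/-- A neighbourhood of `ζ` contains a small open set well inside the disk, where `dv_s` dominates a
multiple of area. Concentration at `ζ` needs this positivity. -/
theorem bergmanMeasure_inter_closedBall_pos {s : ℝ} (hs : -1 < s) {ζ : ℂ} (hζ : ‖ζ‖ = 1)
    {u : Set ℂ} (hu : IsOpen u) (hmem : ζ ∈ u) : 0 < bergmanMeasure s (u ∩ closedBall 0 1) := by
  have hcl : ζ ∈ closure (ball (0 : ℂ) 1) := by
    rw [closure_ball _ one_ne_zero]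
    simp [hζ]
  obtain ⟨w, hwu, hw⟩ := mem_closure_iff.1 hcl u hu hmem
  have hw1 : ‖w‖ < 1 := by simpa using hw
  set ρ : ℝ := (1 + ‖w‖) / 2 with hρdef
  have hρ1 : ρ < 1 := by rw [hρdef]; linarith
  obtain ⟨C, -, -, hle⟩ := exists_restrict_le_bergmanMeasure hs hρ1
  rw [pos_iff_ne_zero]
  intro h0
  have h1 := hle (u ∩ closedBall 0 1)
  rw [Measure.smul_apply, h0, smul_zero, nonpos_iff_eq_zero] at h1
  have h2 : volume (u ∩ ball (0 : ℂ) ρ) ≤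
      volume.restrict (closedBall (0 : ℂ) ρ) (u ∩ closedBall 0 1) := by
    refine le_trans (measure_mono fun z hz => ?_) (Measure.le_restrict_apply _ _)
    exact ⟨⟨hz.1, closedBall_subset_closedBall hρ1.le (ball_subset_closedBall hz.2)⟩,
      ball_subset_closedBall hz.2⟩
  have h3 : 0 < volume (u ∩ ball (0 : ℂ) ρ) :=
    (hu.inter isOpen_ball).measure_pos volume
      ⟨w, hwu, by rw [mem_ball_zero_iff, hρdef]; linarith⟩
  exact absurd (h2.trans h1.le) (not_le.2 h3)

/-- This makes `(1 + ζ̄z)/2` a peak function at `ζ`: in the closed unit disk, `|1 + w| = 2` only for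
`w = 1`. -/
theorem norm_one_add_conj_mul_lt_two {ζ z : ℂ} (hζ : ‖ζ‖ = 1) (hz : ‖z‖ ≤ 1) (hne : z ≠ ζ) :
    ‖1 + (starRingEnd ℂ) ζ * z‖ < 2 := by
  set w := (starRingEnd ℂ) ζ * z with hw
  have hw1 : ‖w‖ ≤ 1 := by rwa [hw, norm_mul, RCLike.norm_conj, hζ, one_mul]
  have hw2 : w ≠ 1 := by
    intro h
    apply hne
    have hζζ : ζ * (starRingEnd ℂ) ζ = 1 := by
      rw [Complex.mul_conj, Complex.normSq_eq_norm_sq, hζ]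
      norm_num
    rw [← one_mul z, ← hζζ, mul_assoc, ← hw, h, mul_one]
  have h1 : ‖w‖ ^ 2 = w.re ^ 2 + w.im ^ 2 := by
    rw [← Complex.normSq_eq_norm_sq, Complex.normSq_apply]; ring
  have h2 : ‖1 + w‖ ^ 2 = (1 + w.re) ^ 2 + w.im ^ 2 := by
    rw [← Complex.normSq_eq_norm_sq, Complex.normSq_apply]; simp; ring
  have h3 : ‖w‖ ^ 2 ≤ 1 := pow_le_one₀ (norm_nonneg _) hw1
  have h4 : w.re < 1 := by
    by_contra! h
    have him : w.im = 0 := by nlinarith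
    have hre : w.re = 1 := by nlinarith
    exact hw2 (Complex.ext (by simpa using hre) (by simpa using him))
  nlinarith [norm_nonneg (1 + w)]

/-- Around each boundary point of the disk there is a sequence of unit vectors of `A²_s(D)` whose
mass concentrates at that point. -/
theorem exists_concentrating_seq {s : ℝ} (hs : -1 < s) {ζ : ℂ} (hζ : ‖ζ‖ = 1) :
    ∃ (e : ℕ → bergmanSpace s) (G : ℕ → ℂ → ℂ), (∀ n, IsHolomorphicRep s (e n) (G n)) ∧
      (∀ n, ‖e n‖ = 1) ∧ ∀ g : ℂ → ℝ, Integrable g (bergmanMeasure s) →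
        ContinuousWithinAt g (closedBall 0 1) ζ →
        Tendsto (fun n => ∫ z, ‖G n z‖ ^ 2 * g z ∂bergmanMeasure s) atTop (𝓝 (g ζ)) := by
  have := isFiniteMeasure_bergmanMeasure hs
  set p : ℂ → ℂ := fun z => (1 + (starRingEnd ℂ) ζ * z) / 2 with hp
  have hpζ : p ζ = 1 := by
    rw [hp]
    simp only [← Complex.normSq_eq_conj_mul_self, Complex.normSq_eq_norm_sq, hζ]
    norm_num
  have hplt : ∀ z ∈ closedBall (0 : ℂ) 1, z ≠ ζ → ‖p z‖ < 1 := by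
    intro z hz hne
    have := norm_one_add_conj_mul_lt_two hζ (by simpa using hz) hne
    rw [hp, norm_div, Complex.norm_ofNat, div_lt_one two_pos]
    exact this
  have hple : ∀ z ∈ closedBall (0 : ℂ) 1, ‖p z‖ ≤ 1 := by
    intro z hz
    rcases eq_or_ne z ζ with rfl | hne
    · rw [hpζ, norm_one]
    · exact (hplt z hz hne).le
  have hdiff : ∀ n : ℕ, DifferentiableOn ℂ (fun z => p z ^ n) (ball 0 1) := fun n => by
    rw [hp]; fun_prop
  have hmem : ∀ n : ℕ, MemLp (fun z => p z ^ n) 2 (bergmanMeasure s) := by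
    intro n
    refine MemLp.of_bound (aestronglyMeasurable_bergmanMeasure (hdiff n)) 1 ?_
    filter_upwards [ae_mem_ball_bergmanMeasure s] with z hz
    rw [norm_pow]
    exact pow_le_one₀ (norm_nonneg _) (hple z (ball_subset_closedBall hz))
  have hrep : ∀ n : ℕ, IsHolomorphicRep s (hmem n).toLp (fun z => p z ^ n) :=
    fun n => ⟨hdiff n, (hmem n).coeFn_toLp⟩
  let f : ℕ → bergmanSpace s := fun n => ⟨(hmem n).toLp, _, hrep n⟩
  have hf : ∀ n, IsHolomorphicRep s (f n) (fun z => p z ^ n) := hrep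
  have hf0 : ∀ n, ‖f n‖ ≠ 0 := by
    intro n h0
    have h1 : (f n : Lp ℂ 2 (bergmanMeasure s)) = 0 := by
      rw [norm_eq_zero] at h0
      rw [h0]
      rfl
    have h2 : IsHolomorphicRep s (f n : Lp ℂ 2 (bergmanMeasure s)) 0 := by
      rw [h1]
      exact ⟨differentiableOn_const 0, Lp.coeFn_zero _ _ _⟩
    have h3 := (hf n).eqOn hs h2 (mem_ball_self one_pos)
    simp [hp] at h3
  have hc : ∀ (n : ℕ) z, ‖p z ^ n‖ ^ 2 = (‖p z‖ ^ 2) ^ n := fun n z => by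
    rw [norm_pow, ← pow_mul, ← pow_mul, mul_comm]
  refine ⟨fun n => ((‖f n‖⁻¹ : ℝ) : ℂ) • f n, fun n => ((‖f n‖⁻¹ : ℝ) : ℂ) • fun z => p z ^ n,
    fun n => (hf n).const_smul _, fun n => ?_, fun g hg hgc => ?_⟩
  · rw [norm_smul, Complex.norm_real, norm_inv, norm_norm, inv_mul_cancel₀ (hf0 n)]
  · have hrestr : (bergmanMeasure s).restrict (closedBall 0 1) = bergmanMeasure s :=
      Measure.restrict_eq_self_of_ae_mem <| by
        filter_upwards [ae_mem_ball_bergmanMeasure s] with z hz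
        exact ball_subset_closedBall hz
    -- The probability densities proportional to `(|p|²)^n` concentrate at the unique maximum `ζ` of
    -- `|p|²`; the normalising integral is `‖f n‖²`.
    have h1 := tendsto_setIntegral_pow_smul_of_unique_maximum_of_isCompact_of_measure_nhdsWithin_pos
      (μ := bergmanMeasure s) (isCompact_closedBall (0 : ℂ) 1)
      (fun u hu hmem => bergmanMeasure_inter_closedBall_pos hs hζ hu hmem)
      (c := fun z => ‖p z‖ ^ 2) (x₀ := ζ) (by rw [hp]; fun_prop)
      (fun z hz hne => by
        rw [hpζ, norm_one, one_pow]
        exact pow_lt_one₀ (norm_nonneg _) (hplt z hz hne) two_ne_zero)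
      (fun z _ => by positivity) (by rw [hpζ]; norm_num) (by simp [hζ]) hg.integrableOn hgc
    rw [hrestr] at h1
    refine h1.congr fun n => ?_
    rw [smul_eq_mul, ← integral_const_mul]
    have hn : ∫ z, (‖p z‖ ^ 2) ^ n ∂bergmanMeasure s = ‖f n‖ ^ 2 := by
      simp only [← hc]
      exact (hf n).norm_sq_eq_integral.symm
    rw [hn]
    refine integral_congr_ae (Eventually.of_forall fun z => ?_)
    simp only [Pi.smul_apply, smul_eq_mul, norm_mul, mul_pow, hc, Complex.norm_real, norm_inv,
      norm_norm, inv_pow]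
    ring

theorem bergmanMeasure_singleton (s : ℝ) (z : ℂ) : bergmanMeasure s {z} = 0 :=
  withDensity_absolutelyContinuous _ _
    (Measure.absolutelyContinuous_of_le Measure.restrict_le_self (measure_singleton z))

/-- The indicator of the complement of a ball about `ζ` is continuous at `ζ` with value `0`, so
testing against it shows that the mass outside the ball vanishes. -/
theorem tendsto_inner_zero_of_isHolomorphicRep {s : ℝ} (hs : -1 < s) {ζ : ℂ}
    {e : ℕ → bergmanSpace s} {G : ℕ → ℂ → ℂ} (hG : ∀ n, IsHolomorphicRep s (e n) (G n))
    (he : ∀ n, ‖e n‖ = 1) (hc : ∀ g : ℂ → ℝ, Integrable g (bergmanMeasure s) →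
      ContinuousWithinAt g (closedBall 0 1) ζ →
      Tendsto (fun n => ∫ z, ‖G n z‖ ^ 2 * g z ∂bergmanMeasure s) atTop (𝓝 (g ζ)))
    (y : bergmanSpace s) : Tendsto (fun n => inner ℂ y (e n)) atTop (𝓝 0) := by
  have := isFiniteMeasure_bergmanMeasure hs
  refine tendsto_inner_zero_of_concentrating (bergmanMeasure_singleton s ζ)
    (e := fun n => (e n : Lp ℂ 2 (bergmanMeasure s))) he (fun ε hε => ?_) y
  have hU : MeasurableSet (ball ζ ε)ᶜ := measurableSet_ball.compl
  have hζ : ζ ∉ (ball ζ ε)ᶜ := notMem_compl_iff.2 (mem_ball_self hε)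
  have h1 := hc ((ball ζ ε)ᶜ.indicator 1) ((integrable_const 1).indicator hU) (by
    refine ContinuousAt.continuousWithinAt (ContinuousAt.congr continuousAt_const
      (f := fun _ => (0 : ℝ)) ?_)
    filter_upwards [ball_mem_nhds ζ hε] with z hz
    rw [indicator_of_notMem (notMem_compl_iff.2 hz)])
  rw [indicator_of_notMem hζ] at h1
  refine h1.congr fun n => ?_
  rw [← integral_indicator hU]
  refine integral_congr_ae ?_
  filter_upwards [(hG n).2] with z hz
  by_cases h : z ∈ (ball ζ ε)ᶜ
  · simp [indicator_of_mem h, hz]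
  · simp [indicator_of_notMem h]

/-! ### The boundary obstruction and the main theorem -/

theorem IsCompositionOperator.comp_eq {s : ℝ} {φ ψ : ℂ → ℂ}
    {T S : bergmanSpace s →L[ℂ] bergmanSpace s} (hT : IsCompositionOperator s φ T)
    (hS : IsCompositionOperator s ψ S) (hinv : ∀ z ∈ ball (0 : ℂ) 1, ψ (φ z) = z)
    (f : bergmanSpace s) : T (S f) = f := by
  obtain ⟨g, hg⟩ := f.2
  refine Subtype.ext ((hT _ _ (hS f g hg)).unique (hg.congr fun z hz => ?_))
  simp only [Function.comp_apply, hinv z hz]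

/-- A composition operator with disk automorphism `c • diskInvolution a` is essentially normal
only if `a = 0`. -/
theorem IsCompositionOperator.eq_zero_of_isEssentiallyNormal {s : ℝ} [hs : Fact (-1 < s)]
    {a c : ℂ} (ha : ‖a‖ < 1) (hc : ‖c‖ = 1) {φ ψ : ℂ → ℂ}
    (hφ : ∀ z ∈ ball (0 : ℂ) 1, φ z = c * diskInvolution a z)
    (hψ : ∀ z ∈ ball (0 : ℂ) 1, ψ z = (starRingEnd ℂ) c * diskInvolution (c * a) z)
    {T S : bergmanSpace s →L[ℂ] bergmanSpace s} (hT : IsCompositionOperator s φ T)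
    (hS : IsCompositionOperator s ψ S) (hTS : ∀ f, T (S f) = f) (hess : IsEssentiallyNormal T) :
    a = 0 := by
  by_contra ha0
  have hfin := isFiniteMeasure_bergmanMeasure hs.out
  have hc' : ‖(starRingEnd ℂ) c‖ = 1 := by rwa [RCLike.norm_conj]
  have hab : ‖c * a‖ = ‖a‖ := by rw [norm_mul, hc, one_mul]
  have hb : ‖c * a‖ < 1 := hab.trans_lt ha
  have hca : (starRingEnd ℂ) c * (c * a) = a := by
    rw [← mul_assoc, ← Complex.normSq_eq_conj_mul_self, Complex.normSq_eq_norm_sq, hc]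
    simp
  obtain ⟨ζ, hζ, hlt⟩ := exists_diskDilation_mul_lt_one ha0 ha hab
  obtain ⟨e, G, hG, he, hconc⟩ := exists_concentrating_seq hs.out hζ
  have hlim : ∀ d : ℂ, ‖d‖ < 1 → Tendsto
      (fun n => ∫ z, ‖G n z‖ ^ 2 * diskDilation d z ^ (s + 2) ∂bergmanMeasure s) atTop
      (𝓝 (diskDilation d ζ ^ (s + 2))) := by
    intro d hd
    have hcont := continuousOn_diskDilation_rpow (s := s) hd
    refine hconc _ ?_ (hcont ζ (by simp [hζ]))
    have hrestr : (bergmanMeasure s).restrict (closedBall 0 1) = bergmanMeasure s :=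
      Measure.restrict_eq_self_of_ae_mem <| by
        filter_upwards [ae_mem_ball_bergmanMeasure s] with z hz
        exact ball_subset_closedBall hz
    rw [← hrestr]
    exact hcont.integrableOn_compact (isCompact_closedBall 0 1)
  have h1 := hess.one_le_mul_of_tendsto hTS he
    (tendsto_inner_zero_of_isHolomorphicRep hs.out hG he hconc)
    ((hlim _ hb).congr fun n => (hT.norm_sq_eq_integral ha hc hφ (hG n)).symm)
    ((hlim _ ha).congr fun n => by
      have := hS.norm_sq_eq_integral hb hc' hψ (hG n)
      -- For the inverse map the dilation parameter is `c̄ (c a) = a`.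
      rw [hca] at this
      exact this.symm)
  have hpa := diskDilation_pos ha hζ.le
  have hpb := diskDilation_pos hb hζ.le
  rw [← Real.mul_rpow hpb.le hpa.le] at h1
  exact absurd h1 (not_le.2 (Real.rpow_lt_one (by positivity) hlt (by linarith [hs.out])))

theorem theorem2p4 (s : ℝ) [Fact (-1 < s)] (φ : ℂ → ℂ) (hφ : IsDiskAutomorphism φ) :
    (∃! T : bergmanSpace s →L[ℂ] bergmanSpace s, IsCompositionOperator s φ T) ∧
      ∀ T : bergmanSpace s →L[ℂ] bergmanSpace s, IsCompositionOperator s φ T →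
        (IsEssentiallyNormal T ↔ IsDiskRotation φ) := by
  have hs : -1 < s := Fact.out
  obtain ⟨a, c, ha, hc, he⟩ := hφ.exists_eq_mul_diskInvolution
  obtain ⟨T₀, hT₀⟩ := exists_isCompositionOperator_of_eqOn_diskInvolution hs ha hc he
  refine ⟨⟨T₀, hT₀, fun T hT => hT.ext hT₀⟩, fun T hT => ?_⟩
  have hc' : ‖(starRingEnd ℂ) c‖ = 1 := by rwa [RCLike.norm_conj]
  have hb : ‖c * a‖ < 1 := by rwa [norm_mul, hc, one_mul]
  obtain ⟨S, hS⟩ := exists_isCompositionOperator_of_eqOn_diskInvolution hs hb hc'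
    (φ := fun z => (starRingEnd ℂ) c * diskInvolution (c * a) z) fun _ _ => rfl
  have hTS := hT.comp_eq hS fun z hz => by
    rw [he z hz]
    exact mul_diskInvolution_mul_diskInvolution ha hc (by simpa using hz)
  refine ⟨fun hess => ?_, fun ⟨d, _, hd⟩ => ?_⟩
  · have ha0 := hT.eq_zero_of_isEssentiallyNormal ha hc he (fun _ _ => rfl) hS hTS hess
    -- The sign appears because `τ_0(z) = -z`.
    refine ⟨-c, by rwa [norm_neg], fun z hz => ?_⟩
    rw [he z hz, ha0]
    simp [diskInvolution]
  -- Compare values at `0`: a rotation fixes it, while `c τ_a` sends it to `c a`.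
  · have ha0 : a = 0 := by
      have h1 := he 0 (mem_ball_self one_pos)
      rw [hd 0 (mem_ball_self one_pos)] at h1
      have hc0 : c ≠ 0 := norm_pos_iff.1 (hc ▸ one_pos)
      simpa [diskInvolution, hc0] using h1
    refine isEssentiallyNormal_of_isometry hTS fun f => ?_
    obtain ⟨g, hg⟩ := f.2
    have h1 := hT.norm_sq_eq_integral ha hc he hg
    simp only [ha0, diskDilation, mul_zero, map_zero, zero_mul, sub_zero, norm_zero, norm_one,
      ne_eq, OfNat.ofNat_ne_zero, not_false_eq_true, zero_pow, one_pow, div_one, Real.one_rpow,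
      mul_one] at h1
    rw [← hg.norm_sq_eq_integral] at h1
    exact (sq_eq_sq₀ (norm_nonneg _) (norm_nonneg _)).1 h1
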